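/- Let $q$ be a prime power, $r\ge 1$, $\mathbb F_q\subseteq\mathbb F_{q^r}$, and let $N_1,N_2>1$ be integers with $N_1-1\mid q^r-1$ and $N_2-1\mid q-1$. Let $J\subseteq\{1,2\}$, put $T_j=N_j-2$ for $j\in J$ and $T_j=N_j-1$ for $j\notin J$, $E_J=\{0,\dots,T_1\}\times\{0,\dots,T_2\}$, and $n_J=(T_1+1)(T_2+1)$. Let $Z_J\subseteq\mathbb F_{q^r}^2$ be the set of common zeros of $X_j^{N_j-1}-1$ ($j\in J$) and $X_j^{N_j}-X_j$ ($j\notin J$). Exponent vectors are reduced into $E_J$ coordinatewise: modulo $N_j-1$ into $\{0,\dots,N_j-2\}$ if $j\in J$; if $j\notin J$, $0$ is kept and positive exponents are reduced modulo $N_j-1$ into $\{1,\dots,N_j-1\}$. For $\boldsymbol a\in E_J$ let $I_{\boldsymbol a}=\{\overline{q^i\boldsymbol a}: i\ge 0\}$ be its (reduced) cyclotomic set. For $\Delta\subseteq E_J$ the code defined by $\Delta$ is the subfield subcode $\{c\in\mathbb F_q^{Z_J}: c\in \operatorname{Span}_{\mathbb F_{q^r}}\{(X^{\boldsymbol a}(P))_{P\in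 Z_J}:\boldsymbol a\in\Delta\}\}$. Let $\mathcal A=\{a_0=0<a_1<a_2<\cdots\}$ be the ordered set of minimal representatives of the cyclotomic sets in the first variable, and assume that $T_2\ge 2$ and that $a_1,a_2$ exist. Put $$\Delta_C=I_{(0,0)}\cup I_{(0,1)}\cup I_{(0,2)},\qquad \Delta_D=\Delta_C\cup I_{(a_1,0)}\cup I_{(a_2,0)},$$ and let $C,D\subseteq\mathbb F_q^{n_J}$ be the codes defined by $\Delta_C$ and $\Delta_D$; let $C\star D$ be the span of all componentwise products of a word of $C$ with a word of $D$. Then $\Delta_C=\{(0,0),(0,1),(0,2)\}$, $\#Z_J=n_J$, the minimum distance of $D^\perp$ is $4$, and $\dim (C\star D)^\perp\ge n_J-(6r+5)$. Moreover, if $C\star D\ne\mathbb F_q^{n_J}$ (in particular whenever $n_J>6r+5$), then $C$ and $D$ provide a PIR scheme of length $n_J$, privacy level $3$ and rate at least $\frac{n_J-(6r+5)}{n_J}$. That is: for every number $M$ of files, each consisting of $b\geq 1$ blocks encoded by $C$ and stored on $n_J$ servers (one codeword symbol per block and server), there is a scheme (for some number $b$ of blocks and some number $s\ge 1$ of rounds)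 in which every server receives $s$ vectors of coefficients in $\mathbb F_q^{M b}$ and returns the $s$ corresponding linear combinations of its stored symbols, such that 1. the queries are obtained by drawing, for each round, file and block, an independent uniformly random codeword of $D$ and sending its $j$-th symbol to server $j$, after a fixed vector depending only on the round and the block has been added for the desired file; 2. the queries and answers always determine the desired file; 3. the joint distribution of the queries received by any at most $3$ servers does not depend on which file is desired; 4. the rate, that is, file size over downloaded symbols $\frac{b\dim C}{s\,n_J}$, is at least $\frac{n_J-(6r+5)}{n_J}$. -/

import Mathlib

noncomputable section

/-! ## Linear codes -/

namespace Code

variable {K ι : Type*} [Field K]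

/-- The Euclidean dual of a linear code. -/
def dual [Fintype ι] (C : Submodule K (ι → K)) : Submodule K (ι → K) where
  carrier := {x | ∀ c ∈ C, ∑ i, c i * x i = 0}
  zero_mem' := by intro c _; simp
  add_mem' := by
    intro x y hx hy c hc
    simp only [Pi.add_apply, mul_add, Finset.sum_add_distrib]
    rw [hx c hc, hy c hc, add_zero]
  smul_mem' := by
    intro a x hx c hc
    simp only [Pi.smul_apply, smul_eq_mul, mul_left_comm _ a, ← Finset.mul_sum]
    rw [hx c hc, mul_zero]

/-- The componentwise (Schur, star) product `C ⋆ D`: the span of all `c ⋆ d`. -/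
def star (C D : Submodule K (ι → K)) : Submodule K (ι → K) :=
  Submodule.span K {x | ∃ c ∈ C, ∃ d ∈ D, x = fun i => c i * d i}

open scoped Classical in
/-- `C` has a nonzero codeword, and `w` is the smallest Hamming weight of one. -/
def HasMinDist [Fintype ι] (C : Submodule K (ι → K)) (w : ℕ) : Prop :=
  IsLeast {v : ℕ | ∃ c ∈ C, c ≠ 0 ∧ hammingNorm c = v} w

end Code

/-! ## Private information retrieval from coded storage

There are `M` files.  Each file consists of `stripes` blocks, each encoded by the storage code
`C ⊆ K^ι`; identifying a block with its codeword, a file is an element of `Fin stripes → C`, and it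
has `stripes * dim C` symbols.  Server `j : ι` stores the `j`-th symbol of every codeword. -/

/-- A (linear, one-shot) PIR scheme for `M` files stored with the code `C`.  To retrieve file `i`
the user draws a query tuple from `queries i` and sends its `j`-th entry to server `j`, which, for
each of the `rounds` requested linear combinations of its stored symbols, returns one symbol. -/
structure PIRScheme {K ι : Type*} [Field K] (C : Submodule K (ι → K)) (M : ℕ) where
  stripes : ℕ
  rounds : ℕ
  stripes_pos : 0 < stripes
  rounds_pos : 0 < rounds
  /-- the distribution of the queries sent when file `i` is desired -/
  queries : Fin M → PMF (ι → Fin rounds → Fin M → Fin stripes → K)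
  /-- the queries and the answers of all the servers always determine the desired file -/
  correct : ∀ (i : Fin M), ∀ Q ∈ (queries i).support, ∀ X X' : Fin M → Fin stripes → C,
    (∀ (j : ι) (t : Fin rounds),
      ∑ m, ∑ b, Q j t m b * (X m b : ι → K) j = ∑ m, ∑ b, Q j t m b * (X' m b : ι → K) j) →
    X i = X' i

namespace PIRScheme

variable {K ι : Type*} [Field K] {C : Submodule K (ι → K)} {M : ℕ}

/-- PIR rate: number of symbols of the requested file over number of downloaded symbols. -/
def rate [Fintype ι] (S : PIRScheme C M) : ℚ :=
  ((S.stripes * Module.finrank K C : ℕ) : ℚ) / ((S.rounds * Fintype.card ι : ℕ) : ℚ)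

/-- Privacy level `t`: the queries received by any at most `t` servers, taken jointly, have a
distribution that does not depend on the desired file. -/
def ResistsCollusion (S : PIRScheme C M) (t : ℕ) : Prop :=
  ∀ T : Finset ι, T.card ≤ t → ∀ i i' : Fin M,
    (S.queries i).map (fun Q (j : T) => Q j) = (S.queries i').map (fun Q (j : T) => Q j)

/-- The scheme uses the retrieval code `D`: for every round, file and stripe an independent uniform
codeword of `D` is drawn and its `j`-th symbol is sent to server `j`, after a fixed vector
(depending on round and stripe only) has been added for the desired file. -/
def UsesRetrievalCode [Finite K] [Finite ι] (S : PIRScheme C M) (D : Submodule K (ι → K)) : Prop :=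
  letI : Fintype (Fin S.rounds → Fin M → Fin S.stripes → D) := Fintype.ofFinite _
  ∃ e : Fin S.rounds → Fin S.stripes → ι → K, ∀ i : Fin M,
    S.queries i = (PMF.uniformOfFintype (Fin S.rounds → Fin M → Fin S.stripes → D)).map
      (fun d j t m b => (d t m b : ι → K) j + if m = i then e t b j else 0)

end PIRScheme

/-! ## `J`-affine variety codes and their subfield subcodes -/

namespace JAffine

variable {m : ℕ}

/-- The zero locus in `L^m` of `X_j^{N_j - 1} - 1` (`j ∈ J`) and `X_j^{N_j} - X_j` (`j ∉ J`). -/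
def Points (L : Type*) [Field L] (N : Fin m → ℕ) (J : Finset (Fin m)) : Type _ :=
  {P : Fin m → L // ∀ j, (j ∈ J → P j ^ (N j - 1) = 1) ∧ (j ∉ J → P j ^ N j = P j)}

instance (L : Type*) [Field L] [Finite L] (N : Fin m → ℕ) (J : Finset (Fin m)) :
    Fintype (Points L N J) :=
  haveI : Finite (Points L N J) := Subtype.finite
  Fintype.ofFinite _

/-- The number `T_j + 1` of exponents in coordinate `j`. -/
def size (N : Fin m → ℕ) (J : Finset (Fin m)) (j : Fin m) : ℕ :=
  if j ∈ J then N j - 1 else N j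

/-- The length `n_J = ∏_{j ∉ J} N_j * ∏_{j ∈ J} (N_j - 1)`. -/
def length (N : Fin m → ℕ) (J : Finset (Fin m)) : ℕ := ∏ j, size N J j

/-- The set `E_J = ∏_j {0, …, T_j}` of exponents. -/
def exponents (N : Fin m → ℕ) (J : Finset (Fin m)) : Set (Fin m → ℕ) :=
  {a | ∀ j, a j < size N J j}

/-- The reduction of an exponent vector into `E_J`: coordinates in `J` are reduced modulo `N_j - 1`
into `{0, …, N_j - 2}`; the others are kept if they are `0` and reduced modulo `N_j - 1` into
`{1, …, N_j - 1}` if they are positive. -/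
def reduce (N : Fin m → ℕ) (J : Finset (Fin m)) (a : Fin m → ℕ) : Fin m → ℕ := fun j =>
  if j ∈ J then a j % (N j - 1)
  else if a j = 0 then 0 else (a j - 1) % (N j - 1) + 1

/-- The minimal cyclotomic set of `a` with respect to `q`: all `q^i • a`, reduced into `E_J`. -/
def cyclotomic (q : ℕ) (N : Fin m → ℕ) (J : Finset (Fin m)) (a : Fin m → ℕ) : Set (Fin m → ℕ) :=
  Set.range fun i : ℕ => reduce N J fun j => q ^ i * a j

/-- The representatives of the minimal cyclotomic sets: their lexicographically least elements. -/
def representatives (q : ℕ) (N : Fin m → ℕ) (J : Finset (Fin m)) : Set (Fin m → ℕ) :=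
  {a | a ∈ exponents N J ∧ ∀ b ∈ cyclotomic q N J a, toLex a ≤ toLex b}

/-- The `J`-affine variety code over `L`: the span of the evaluations of `X^a`, `a ∈ Δ`. -/
def code (L : Type*) [Field L] (N : Fin m → ℕ) (J : Finset (Fin m)) (Δ : Set (Fin m → ℕ)) :
    Submodule L (Points L N J → L) :=
  Submodule.span L {v | ∃ a ∈ Δ, v = fun P => ∏ j, P.1 j ^ a j}

/-- The subfield subcode over `K` of a `J`-affine variety code over `L`: all words over `K` that,
read over `L` through the embedding `K → L` in every coordinate, lie in the code. -/
def subfieldSubcode (K L : Type*) [Field K] [Field L] [Algebra K L]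
    (N : Fin m → ℕ) (J : Finset (Fin m)) (Δ : Set (Fin m → ℕ)) :
    Submodule K (Points L N J → K) :=
  ((code L N J Δ).restrictScalars K).comap ((Algebra.linearMap K L).compLeft (Points L N J))

/-- The ordered set `{a_0 = 0 < a_1 < a_2 < …}` of those `a` for which `(a, 0)` represents a minimal
cyclotomic set in two variables (that is, of the minimal representatives of the cyclotomic cosets in
the first variable). -/
def firstReps (q : ℕ) (N : Fin 2 → ℕ) (J : Finset (Fin 2)) : Set ℕ :=
  {a | ![a, 0] ∈ representatives q N J}

/-- `Δ_C = I_{(0,0)} ∪ I_{(0,1)} ∪ I_{(0,2)}`. -/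
def deltaC (q : ℕ) (N : Fin 2 → ℕ) (J : Finset (Fin 2)) : Set (Fin 2 → ℕ) :=
  cyclotomic q N J ![0, 0] ∪ cyclotomic q N J ![0, 1] ∪ cyclotomic q N J ![0, 2]

/-- `Δ_D = I_{(0,0)} ∪ I_{(0,1)} ∪ I_{(0,2)} ∪ I_{(a₁,0)} ∪ I_{(a₂,0)}`. -/
def deltaD (q : ℕ) (N : Fin 2 → ℕ) (J : Finset (Fin 2)) (a₁ a₂ : ℕ) : Set (Fin 2 → ℕ) :=
  deltaC q N J ∪ cyclotomic q N J ![a₁, 0] ∪ cyclotomic q N J ![a₂, 0]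

end JAffine

end

/-! ### Linear codes: restriction to few coordinates, information sets, words of weight at most
three -/

noncomputable section

namespace Code

variable {K ι : Type*} [Field K]

/-! Write `x`, `y` for the two coordinates. Since `N 1 - 1 ∣ q - 1`, the values of `y` lie in `K`,
and Delsarte's theorem identifies `C` with the polynomials of degree at most two in `y`, and `D`
with `C + V`, where `V` consists of the functions `c + tr (l x) + tr (l' x^a₂)` and has dimension at
most `2r + 1` (`exists_isHyperbolicPair`). A product of the two has coefficients in `V` at `1, y,
y²` and constant coefficients at `y³, y⁴`, so `star C D` has dimension at most `3(2r + 1) + 2 = 6r +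
5`.

Distance: a word of `dual D` is orthogonal to `1, x, x², y, y²`; this includes `x²` when `a₂ ≠ 2`,
because `2` is then conjugate to `1`. If its weight is at most three, each support point shares its
`x` with another one and its `y` with another one (`exists_ne_eq_of_powerSums_eq_zero`), which
forces a fourth point. Alternating signs on a rectangle attain weight four.

Retrieval: privacy is the dual distance of `D`. There is a set `Q` of at most `3 dim V + 2`
positions all of whose cyclic translates in the `y` direction determine the words of `star C D`
(`exists_determining_set`). Symbols are downloaded at the translates of the complement of `Q`,
arranged so that every stripe is read at three consecutive labels of `y`, which determine a word of
`C`. The rate is then exactly `1 - |Q| / n_J`. -/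

theorem card_le_finrank_dual_add_finrank [Fintype ι] (C : Submodule K (ι → K)) :
    Fintype.card ι ≤ Module.finrank K (dual C) + Module.finrank K C := by
  classical
  let φ : (ι → K) →ₗ[K] Module.Dual K C :=
    LinearMap.mk₂ K (fun x c => ∑ i, (c : ι → K) i * x i)
      (by intros; simp [mul_add, Finset.sum_add_distrib])
      (by intros; simp [mul_left_comm, Finset.mul_sum])
      (by intros; simp [add_mul, Finset.sum_add_distrib])
      (by intros; simp [mul_assoc, Finset.mul_sum])
  have hker : LinearMap.ker φ ≤ dual C := by
    intro x hx c hc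
    have := LinearMap.congr_fun (LinearMap.mem_ker.1 hx) ⟨c, hc⟩
    simpa [φ] using this
  have h1 := LinearMap.finrank_range_add_finrank_ker φ
  have h2 := Submodule.finrank_mono hker
  have h3 := Submodule.finrank_le (LinearMap.range φ)
  rw [Subspace.dual_finrank_eq] at h3
  rw [Module.finrank_fintype_fun_eq_card] at h1
  omega

/-- A code whose dual has no nonzero word of weight at most `t` restricts onto every set of at
most `t` coordinates. -/
theorem exists_mem_restrict_eq [Fintype ι] [DecidableEq K] (D : Submodule K (ι → K)) (t : ℕ)
    (hD : ∀ c ∈ dual D, hammingNorm c ≤ t → c = 0) (T : Finset ι) (hT : T.card ≤ t)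
    (v : ι → K) : ∃ d ∈ D, ∀ j ∈ T, d j = v j := by
  classical
  let ρ : (ι → K) →ₗ[K] (T → K) := LinearMap.funLeft K K (fun j : T => (j : ι))
  have htop : D.map ρ = ⊤ := by
    by_contra hne
    obtain ⟨f, hf0, hf⟩ := Submodule.exists_le_ker_of_lt_top _ (lt_top_iff_ne_top.2 hne)
    apply hf0
    -- A functional that kills the restriction of `D` to `T`, extended by zero, is a dual word
    -- supported in `T`.
    let c : ι → K := fun j => if h : j ∈ T then f (Pi.single ⟨j, h⟩ 1) else 0
    have hfe : ∀ w : T → K, f w = ∑ j : T, w j * c j := by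
      intro w
      conv_lhs => rw [← Finset.univ_sum_single w, map_sum]
      refine Finset.sum_congr rfl fun j _ => ?_
      rw [← smul_eq_mul, show c j = f (Pi.single j 1) from dif_pos j.2, ← map_smul,
        ← Pi.single_smul, smul_eq_mul, mul_one]
    have hc : c = 0 := by
      apply hD
      · intro d hd
        have h0 := hf (Submodule.mem_map_of_mem (f := ρ) hd)
        rw [LinearMap.mem_ker, hfe] at h0
        rw [← h0, ← Finset.sum_subset (Finset.subset_univ T)]
        · exact (Finset.sum_coe_sort T fun j => d j * c j).symm
        · intro j _ hj
          simp [c, hj]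
      · refine le_trans (Finset.card_le_card ?_) hT
        intro j hj
        by_contra h
        simp [c, h] at hj
    refine LinearMap.ext fun w => ?_
    rw [hfe]
    exact Finset.sum_eq_zero fun j _ => by rw [hc, Pi.zero_apply, mul_zero]
  have hv : ρ v ∈ D.map ρ := htop ▸ Submodule.mem_top
  obtain ⟨d, hd, hdv⟩ := hv
  exact ⟨d, hd, fun j hj => congrFun hdv ⟨j, hj⟩⟩

/-- Every space of functions on a finite set is determined by its values on at most as many points
as its dimension. -/
theorem exists_information_set {α : Type*} [Finite α] (V : Submodule K (α → K)) :
    ∃ I : Finset α, I.card ≤ Module.finrank K V ∧ ∀ v ∈ V, (∀ a ∈ I, v a = 0) → v = 0 := by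
  classical
  let φ : α → Module.Dual K V := fun a => (LinearMap.proj a).comp V.subtype
  -- The information set indexes a basis of the span of the evaluation functionals.
  obtain ⟨b, hb, hspan, hli⟩ := exists_linearIndependent K (Set.range φ)
  have : Finite b := Set.Finite.subset (Set.finite_range φ) hb
  have : Fintype b := Fintype.ofFinite b
  choose s hs using fun x : b => hb x.2
  refine ⟨Finset.univ.image s, ?_, fun v hv h0 => ?_⟩
  · refine Finset.card_image_le.trans ?_
    have := hli.fintype_card_le_finrank
    rwa [Subspace.dual_finrank_eq] at this
  · have hle : Submodule.span K (Set.range φ) ≤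
        LinearMap.ker (Module.Dual.eval K V ⟨v, hv⟩) := by
      rw [← hspan, Submodule.span_le]
      intro x hx
      have h1 := h0 (s ⟨x, hx⟩) (Finset.mem_image_of_mem _ (Finset.mem_univ _))
      have h2 : φ (s ⟨x, hx⟩) = x := hs ⟨x, hx⟩
      rw [SetLike.mem_coe, LinearMap.mem_ker, ← h2]
      exact h1
    funext a
    simpa [φ] using hle (Submodule.subset_span (Set.mem_range_self a))

/-- A word of weight at most three whose power sums against `x` of order `0`, `1` and `2` vanish
has no support point with an isolated value of `x`. -/
theorem exists_ne_eq_of_powerSums_eq_zero {F : Type*} [Field F] [Fintype ι] [DecidableEq F]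
    (c x : ι → F) (hw : hammingNorm c ≤ 3) (h0 : ∑ P, c P = 0) (h1 : ∑ P, c P * x P = 0)
    (h2 : ∑ P, c P * x P ^ 2 = 0) (P : ι) (hP : c P ≠ 0) :
    ∃ P', P' ≠ P ∧ c P' ≠ 0 ∧ x P' = x P := by
  classical
  by_contra! hcon
  -- At most two other support points remain; `(x - u) * (x - v)` vanishes at them but not at `P`.
  obtain ⟨u, v, hu, hv, huv⟩ : ∃ u v : F, x P ≠ u ∧ x P ≠ v ∧
      ∀ P', P' ≠ P → c P' ≠ 0 → x P' = u ∨ x P' = v := by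
    have hcard : ((Finset.univ.filter fun P' => c P' ≠ 0).erase P).card ≤ 2 := by
      rw [Finset.card_erase_of_mem (by simpa using hP)]
      have : (Finset.univ.filter fun P' => c P' ≠ 0).card ≤ 3 := hw
      omega
    have hmem : ∀ P', P' ∈ (Finset.univ.filter fun P' => c P' ≠ 0).erase P ↔
        P' ≠ P ∧ c P' ≠ 0 := by simp
    generalize (Finset.univ.filter fun P' => c P' ≠ 0).erase P = s at hcard hmem
    interval_cases hs : s.card
    · rw [Finset.card_eq_zero] at hs
      subst hs
      -- With no other support point, any value different from `x P` serves.
      exact ⟨x P + 1, x P + 1, by simp, by simp,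
        fun P' h h' => absurd ((hmem P').2 ⟨h, h'⟩) (by simp)⟩
    · obtain ⟨A, rfl⟩ := Finset.card_eq_one.1 hs
      have hA := (hmem A).1 (by simp)
      refine ⟨x A, x A, (hcon A hA.1 hA.2).symm, (hcon A hA.1 hA.2).symm, fun P' h h' => ?_⟩
      rw [Finset.mem_singleton.1 ((hmem P').2 ⟨h, h'⟩)]
      exact Or.inl rfl
    · obtain ⟨A, B, -, rfl⟩ := Finset.card_eq_two.1 hs
      have hA := (hmem A).1 (by simp)
      have hB := (hmem B).1 (by simp)
      refine ⟨x A, x B, (hcon A hA.1 hA.2).symm, (hcon B hB.1 hB.2).symm, fun P' h h' => ?_⟩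
      have := (hmem P').2 ⟨h, h'⟩
      rcases Finset.mem_insert.1 this with rfl | h3
      · exact Or.inl rfl
      · rw [Finset.mem_singleton.1 h3]; exact Or.inr rfl
  have hsum : ∑ P', c P' * ((x P' - u) * (x P' - v)) = 0 := by
    have : ∀ P', c P' * ((x P' - u) * (x P' - v)) =
        c P' * x P' ^ 2 - (u + v) * (c P' * x P') + u * v * c P' := fun P' => by ring
    simp_rw [this, Finset.sum_add_distrib, Finset.sum_sub_distrib, ← Finset.mul_sum, h0, h1, h2]
    ring
  rw [Finset.sum_eq_single P] at hsum
  · rcases mul_eq_zero.1 hsum with h | h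
    · exact hP h
    · rcases mul_eq_zero.1 h with h | h
      · exact hu (sub_eq_zero.1 h)
      · exact hv (sub_eq_zero.1 h)
  · intro P' _ hne
    by_cases hc : c P' = 0
    · rw [hc, zero_mul]
    · rcases huv P' hne hc with h | h <;> rw [h] <;> ring
  · simp

/-- A word of weight at most three all of whose power sums of order at most two against two
functions that jointly separate points vanish is zero. -/
theorem eq_zero_of_powerSums_eq_zero {F : Type*} [Field F] [Fintype ι] [DecidableEq F]
    (c x y : ι → F) (hxy : ∀ P P', x P = x P' → y P = y P' → P = P') (hw : hammingNorm c ≤ 3)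
    (h0 : ∑ P, c P = 0) (hx1 : ∑ P, c P * x P = 0) (hx2 : ∑ P, c P * x P ^ 2 = 0)
    (hy1 : ∑ P, c P * y P = 0) (hy2 : ∑ P, c P * y P ^ 2 = 0) : c = 0 := by
  classical
  by_contra hc
  obtain ⟨P, hP⟩ := Function.ne_iff.1 hc
  obtain ⟨A, hAP, hA, hxA⟩ := exists_ne_eq_of_powerSums_eq_zero c x hw h0 hx1 hx2 P hP
  obtain ⟨B, hBP, hB, hyB⟩ := exists_ne_eq_of_powerSums_eq_zero c y hw h0 hy1 hy2 P hP
  have hAB : A ≠ B := by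
    rintro rfl
    exact hAP (hxy _ _ hxA hyB)
  -- `A` shares `x` with `P` and `B` shares `y` with `P`; the partner of `A` in `y` must be a fourth
  -- point.
  obtain ⟨E, hEA, hE, hyE⟩ := exists_ne_eq_of_powerSums_eq_zero c y hw h0 hy1 hy2 A hA
  have hEP : E ≠ P := by
    rintro rfl
    exact hAP (hxy _ _ hxA hyE.symm)
  have hEB : E ≠ B := by
    rintro rfl
    exact hAP (hxy _ _ hxA (hyE.symm.trans hyB))
  have h4 : ({P, A, B, E} : Finset ι).card = 4 := by
    rw [Finset.card_insert_of_notMem, Finset.card_insert_of_notMem, Finset.card_pair hEB.symm]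
    · simp [hAB, hEA.symm]
    · simp [hAP.symm, hBP.symm, hEP.symm]
  have hsub : ({P, A, B, E} : Finset ι) ⊆ Finset.univ.filter fun P' => c P' ≠ 0 := by
    intro R hR
    simp only [Finset.mem_insert, Finset.mem_singleton] at hR
    rw [Finset.mem_filter]
    rcases hR with rfl | rfl | rfl | rfl <;> exact ⟨Finset.mem_univ _, by assumption⟩
  have := (Finset.card_le_card hsub).trans hw
  omega

end Code

/-! ### Privacy and construction of the retrieval scheme -/

namespace PIRScheme

variable {K ι : Type*} [Field K] {C : Submodule K (ι → K)} {M : ℕ}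

theorem map_uniformOfFintype_of_equiv {α : Type*} [Fintype α] [Nonempty α] (e : α ≃ α) :
    (PMF.uniformOfFintype α).map e = PMF.uniformOfFintype α := by
  ext a
  rw [PMF.map_apply, tsum_eq_single (e.symm a)]
  · simp
  · intro b hb
    rw [if_neg]
    rintro rfl
    simp at hb

/-- If `dual D` has no nonzero word of weight at most `t`, a scheme with retrieval code `D` has
privacy level `t`. -/
theorem UsesRetrievalCode.resistsCollusion [Finite K] [Fintype ι] [DecidableEq K]
    {S : PIRScheme C M} {D : Submodule K (ι → K)} (hS : S.UsesRetrievalCode D) (t : ℕ)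
    (hD : ∀ c ∈ Code.dual D, hammingNorm c ≤ t → c = 0) : S.ResistsCollusion t := by
  classical
  intro T hT
  obtain ⟨e, he⟩ := hS
  choose d hd hde using fun a b => Code.exists_mem_restrict_eq D t hD T hT (e a b)
  let _ : Fintype (Fin S.rounds → Fin M → Fin S.stripes → D) := Fintype.ofFinite _
  suffices h : ∀ i, (S.queries i).map (fun Q (j : T) => Q j) =
      (PMF.uniformOfFintype (Fin S.rounds → Fin M → Fin S.stripes → D)).map
        (fun w (j : T) a m b => (w a m b : ι → K) j) by
    intro i i'
    rw [h i, h i']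
  intro i
  rw [he i, PMF.map_comp]
  -- On `T` the fixed vectors agree with words of `D`, so adding them is a translation, which
  -- preserves the uniform distribution.
  let τ : Fin S.rounds → Fin M → Fin S.stripes → D :=
    fun a m b => if m = i then ⟨d a b, hd a b⟩ else 0
  conv_rhs => rw [← map_uniformOfFintype_of_equiv (Equiv.addRight τ), PMF.map_comp]
  congr 1
  funext w j a m b
  by_cases h : m = i
  · simp [τ, h, hde a b j j.2]
  · simp [τ, h]

open scoped Classical in
/-- The scheme that in round `(g, k)` downloads, modulo `star C D`, the symbols at the translates
`(ρ.1, ρ.2 + g)` of the retrieval positions `ρ ∈ R`, from the stripe `(g - k, ρ)`. -/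
theorem exists_usesRetrievalCode_rate_eq [Finite K] [Fintype ι] {α : Type*} {n : ℕ} [NeZero n]
    (D : Submodule K (ι → K)) (ε : ι ≃ α × ZMod n) (hrank : Module.finrank K C = 3)
    (hC : ∀ c ∈ C, ∀ a z, (∀ k : Fin 3, c (ε.symm (a, z + (k : ℕ))) = 0) → c = 0)
    (R : Finset (α × ZMod n)) (hR : R.Nonempty)
    (hstar : ∀ g, ∀ f ∈ Code.star C D, (∀ p ∉ R, f (ε.symm (p.1, p.2 + g)) = 0) → f = 0) (M : ℕ) :
    ∃ S : PIRScheme C M, S.UsesRetrievalCode D ∧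
      S.rate = (R.card : ℚ) / (Fintype.card ι : ℚ) := by
  have hn := NeZero.pos n
  have hRc : 0 < R.card := hR.card_pos
  -- Stripes are labelled `(h, ρ)` and rounds `(g, k)`. Round `(g, k)` reads stripe `(h, ρ)` exactly
  -- when `g = h + k`, at `ρ` translated by `g`.
  let σ : Fin (n * R.card) ≃ ZMod n × R := (Fintype.equivFinOfCardEq (by simp [ZMod.card])).symm
  let θ : Fin (n * 3) ≃ ZMod n × Fin 3 := (Fintype.equivFinOfCardEq (by simp [ZMod.card])).symm
  let e : Fin (n * 3) → Fin (n * R.card) → ι → K := fun t b j =>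
    if (θ t).1 = (σ b).1 + ((θ t).2 : ℕ) ∧ j = ε.symm ((σ b).2.1.1, (σ b).2.1.2 + (θ t).1)
      then 1 else 0
  let _ : Fintype (Fin (n * 3) → Fin M → Fin (n * R.card) → D) := Fintype.ofFinite _
  refine ⟨⟨n * R.card, n * 3, by positivity, by positivity, fun i =>
    (PMF.uniformOfFintype (Fin (n * 3) → Fin M → Fin (n * R.card) → D)).map
      (fun d j t m b => (d t m b : ι → K) j + if m = i then e t b j else 0), ?_⟩, ⟨e, fun i => rfl⟩,
      ?_⟩
  · intro i Q hQ X X' hX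
    obtain ⟨d, -, rfl⟩ := (PMF.mem_support_map_iff _ _ _).1 hQ
    let Y : Fin M → Fin (n * R.card) → C := fun m b => X m b - X' m b
    let f : Fin (n * 3) → ι → K := fun t j => ∑ b, e t b j * (Y i b : ι → K) j
    have hsum : ∀ t j, ∑ m, ∑ b, (d t m b : ι → K) j * (Y m b : ι → K) j + f t j = 0 := by
      intro t j
      have h := sub_eq_zero.2 (hX j t)
      rw [← Finset.sum_sub_distrib] at h
      simp_rw [← Finset.sum_sub_distrib, ← mul_sub, add_mul, Finset.sum_add_distrib] at h
      rw [← h]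
      congr 1
      rw [Finset.sum_eq_single i (fun m _ hm => by simp [hm]) (by simp)]
      simp [f, Y]
    -- The difference of the desired parts lies in `star C D` and vanishes off the translate of `R`.
    have hf : ∀ t, f t = 0 := by
      intro t
      apply hstar (θ t).1
      · have : f t = -∑ m, ∑ b, fun j => (Y m b : ι → K) j * (d t m b : ι → K) j := by
          funext j
          rw [eq_neg_of_add_eq_zero_right (hsum t j)]
          simp [mul_comm]
        rw [this]
        exact Submodule.neg_mem _ (Submodule.sum_mem _ fun m _ => Submodule.sum_mem _ fun b _ =>
          Submodule.subset_span ⟨_, (Y m b).2, _, (d t m b).2, rfl⟩)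
      · intro p hp
        refine Finset.sum_eq_zero fun b _ => ?_
        rw [mul_eq_zero]
        left
        refine if_neg fun h => hp ?_
        have h2 := ε.symm.injective h.2
        rw [Prod.mk.injEq, add_left_inj] at h2
        have h3 : p = (σ b).2.1 := Prod.ext h2.1 h2.2
        rw [h3]
        exact (σ b).2.2
    -- Rounds `(h + k, k)`, `k = 0, 1, 2`, read stripe `(h, ρ)` at three consecutive positions; no
    -- other stripe contributes there.
    have hY : ∀ b, (Y i b : ι → K) = 0 := by
      intro b
      refine hC _ (Y i b).2 (σ b).2.1.1 ((σ b).2.1.2 + (σ b).1) fun k => ?_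
      have h := congrFun (hf (θ.symm ((σ b).1 + (k : ℕ), k)))
        (ε.symm ((σ b).2.1.1, (σ b).2.1.2 + ((σ b).1 + (k : ℕ))))
      simp only [f, e, Equiv.apply_symm_apply, Pi.zero_apply] at h
      rw [Finset.sum_eq_single b] at h
      · simpa [add_assoc] using h
      · intro b' _ hb'
        rw [mul_eq_zero]
        left
        refine if_neg fun h' => hb' (σ.injective ?_)
        have h2 := ε.symm.injective h'.2
        rw [Prod.mk.injEq, add_left_inj] at h2
        exact Prod.ext (add_right_cancel h'.1).symm (Subtype.ext (Prod.ext h2.1.symm h2.2.symm))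
      · simp
    funext b
    exact Subtype.ext (sub_eq_zero.1 (hY b))
  · have hn' : (n : ℚ) ≠ 0 := by exact_mod_cast hn.ne'
    rw [rate, hrank]
    push_cast
    rw [mul_right_comm, mul_div_mul_left]
    positivity

end PIRScheme
end

/-! ### Trace words, Delsarte's theorem and the size of the zero locus -/

noncomputable section
namespace JAffine

variable {K L : Type*} [Field K] [Field L] [Finite K] [Finite L] [Algebra K L] {m : ℕ}
  {N : Fin m → ℕ} {J : Finset (Fin m)}

variable (K L) in
theorem exists_algEquiv_eq_pow (i : ℕ) : ∃ φ : L ≃ₐ[K] L, ∀ x, φ x = x ^ Nat.card K ^ i := by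
  have := Fintype.ofFinite K
  refine ⟨FiniteField.frobeniusAlgEquivOfAlgebraic K L ^ i, fun x => ?_⟩
  rw [AlgEquiv.coe_pow, FiniteField.coe_frobeniusAlgEquivOfAlgebraic_iterate,
    Fintype.card_eq_nat_card]

omit [Finite K] in
-- An element fixed by Frobenius factors out of every term of the trace `∑ (l * y)^(q^i)`.
theorem algebraMap_trace_mul_of_pow_eq (l y : L) (hy : y ^ Nat.card K = y) :
    algebraMap K L (Algebra.trace K L (l * y)) = algebraMap K L (Algebra.trace K L l) * y := by
  have h : ∀ i, y ^ Nat.card K ^ i = y := by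
    intro i
    induction i with
    | zero => simp
    | succ i ih => rw [pow_succ, pow_mul, ih, hy]
  simp_rw [FiniteField.algebraMap_trace_eq_sum_pow, mul_pow, h, Finset.sum_mul]

theorem trace_pow_card_pow (x : L) (i : ℕ) :
    Algebra.trace K L (x ^ Nat.card K ^ i) = Algebra.trace K L x := by
  obtain ⟨φ, hφ⟩ := exists_algEquiv_eq_pow K L i
  rw [← hφ, Algebra.trace_eq_of_algEquiv]

theorem eq_zero_of_trace_mul_eq_zero (x : L) (h : ∀ l, Algebra.trace K L (l * x) = 0) : x = 0 :=
  (traceForm_nondegenerate K L).1 x fun l => by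
    rw [Algebra.traceForm_apply, mul_comm, h]

omit [Finite L] in
theorem pow_mod_sub_one_add_one {x : L} {n a : ℕ} (hn : 1 < n) (hx : x ^ n = x) (ha : a ≠ 0) :
    x ^ ((a - 1) % (n - 1) + 1) = x ^ a := by
  by_cases h0 : x = 0
  · rw [h0, zero_pow ha, zero_pow (by omega)]
  · have h1 : x ^ (n - 1) = 1 := by
      apply mul_right_cancel₀ h0
      rw [← pow_succ, Nat.sub_add_cancel hn.le, hx, one_mul]
    rw [pow_succ, ← pow_eq_pow_mod _ h1, ← pow_succ, Nat.sub_add_cancel (by omega)]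

omit [Finite L] in
theorem prod_pow_reduce (hN : ∀ j, 1 < N j) (P : Points L N J) (a : Fin m → ℕ) :
    ∏ j, P.1 j ^ reduce N J a j = ∏ j, P.1 j ^ a j := by
  refine Finset.prod_congr rfl fun j _ => ?_
  unfold reduce
  split_ifs with h1 h2
  · exact (pow_eq_pow_mod _ ((P.2 j).1 h1)).symm
  · rw [h2]
  · exact pow_mod_sub_one_add_one (hN j) ((P.2 j).2 h1) h2

omit [Finite L] in
theorem prod_pow_reduce_mul (hN : ∀ j, 1 < N j) (P : Points L N J) (q i : ℕ) (a : Fin m → ℕ) :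
    ∏ j, P.1 j ^ reduce N J (fun j => q ^ i * a j) j = (∏ j, P.1 j ^ a j) ^ q ^ i := by
  rw [prod_pow_reduce hN, ← Finset.prod_pow]
  exact Finset.prod_congr rfl fun j _ => by rw [mul_comm, pow_mul]

variable (K) in
/-- The word over `K` of the traces of `l * X^a`. -/
def traceWord (N : Fin m → ℕ) (J : Finset (Fin m)) (l : L) (a : Fin m → ℕ) : Points L N J → K :=
  fun P => Algebra.trace K L (l * ∏ j, P.1 j ^ a j)

omit [Finite K] in
-- The conjugates of `X^a` in the trace are monomials with exponents in the cyclotomic set of `a`.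
theorem traceWord_mem_subfieldSubcode (hN : ∀ j, 1 < N j) {Δ : Set (Fin m → ℕ)} {a : Fin m → ℕ}
    (ha : cyclotomic (Nat.card K) N J a ⊆ Δ) (l : L) :
    traceWord K N J l a ∈ subfieldSubcode K L N J Δ := by
  change (fun P => algebraMap K L (traceWord K N J l a P)) ∈ code L N J Δ
  have : (fun P => algebraMap K L (traceWord K N J l a P)) =
      ∑ i ∈ Finset.range (Module.finrank K L), l ^ Nat.card K ^ i •
        fun P : Points L N J => ∏ j, P.1 j ^ reduce N J (fun j => Nat.card K ^ i * a j) j := by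
    funext P
    rw [traceWord, FiniteField.algebraMap_trace_eq_sum_pow, Finset.sum_apply]
    refine Finset.sum_congr rfl fun i _ => ?_
    rw [Pi.smul_apply, prod_pow_reduce_mul hN, mul_pow, smul_eq_mul]
  rw [this]
  exact Submodule.sum_mem _ fun i _ => Submodule.smul_mem _ _
    (Submodule.subset_span ⟨_, ha ⟨i, rfl⟩, rfl⟩)

/-- Delsarte's theorem for subfield subcodes of affine variety codes. -/
theorem subfieldSubcode_le_span_traceWord (hN : ∀ j, 1 < N j) {Δ S : Set (Fin m → ℕ)}
    (hΔ : ∀ b ∈ Δ, ∃ a ∈ S, b ∈ cyclotomic (Nat.card K) N J a) :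
    subfieldSubcode K L N J Δ ≤
      Submodule.span K {v | ∃ a ∈ S, ∃ l : L, v = traceWord K N J l a} := by
  intro c hc
  change (fun P => algebraMap K L (c P)) ∈ code L N J Δ at hc
  suffices h : ∀ v ∈ code L N J Δ, ∀ μ : L, (fun P => Algebra.trace K L (μ * v P)) ∈
      Submodule.span K {v | ∃ a ∈ S, ∃ l : L, v = traceWord K N J l a} by
    -- With `tr μ = 1`, a `K`-valued word is its own trace after multiplication by `μ`.
    obtain ⟨μ, hμ⟩ := Algebra.trace_surjective K L 1
    convert h _ hc μ using 1
    funext P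
    rw [mul_comm, ← Algebra.smul_def, map_smul, hμ, smul_eq_mul, mul_one]
  intro v hv
  induction hv using Submodule.span_induction with
  | mem v hv =>
    intro μ
    obtain ⟨b, hb, rfl⟩ := hv
    obtain ⟨a, ha, i, rfl⟩ := hΔ b hb
    -- As the trace is Frobenius invariant, the conjugation passes from the monomial to its
    -- coefficient.
    obtain ⟨φ, hφ⟩ := exists_algEquiv_eq_pow K L i
    refine Submodule.subset_span ⟨a, ha, φ.symm μ, funext fun P => ?_⟩
    dsimp only
    rw [prod_pow_reduce_mul hN, traceWord, ← trace_pow_card_pow (φ.symm μ * _) i,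
      mul_pow, ← hφ (φ.symm μ), φ.apply_symm_apply]
  | zero =>
    intro μ
    convert Submodule.zero_mem _ using 1
    funext P
    simp
  | add v w _ _ hv hw =>
    intro μ
    convert Submodule.add_mem _ (hv μ) (hw μ) using 1
    funext P
    simp [mul_add]
  | smul t v _ hv =>
    intro μ
    convert hv (μ * t) using 1
    funext P
    simp [mul_assoc]

/-- The values of the coordinate `j` on the zero locus. -/
def Coord (L : Type*) [Field L] (N : Fin m → ℕ) (J : Finset (Fin m)) (j : Fin m) : Type _ :=
  {x : L // (j ∈ J → x ^ (N j - 1) = 1) ∧ (j ∉ J → x ^ N j = x)}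

instance (j : Fin m) : Finite (Coord L N J j) := Subtype.finite

/-- The divisibility yields a primitive root of unity of order `N j - 1`; for `j ∉ J` the root `0`
is added. -/
theorem card_coord (hN : ∀ j, 1 < N j) (j : Fin m) (hj : N j - 1 ∣ Nat.card L - 1) :
    Nat.card (Coord L N J j) = size N J j := by
  classical
  have hn : 0 < N j - 1 := Nat.sub_pos_of_lt (hN j)
  obtain ⟨ζ, hζ⟩ : ∃ ζ : L, IsPrimitiveRoot ζ (N j - 1) := by
    obtain ⟨g, hg⟩ := IsCyclic.exists_ofOrder_eq_natCard (α := Lˣ)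
    obtain ⟨d, hd⟩ := hj
    rw [Nat.card_units, hd] at hg
    have h := IsPrimitiveRoot.orderOf g
    have h0 : 0 < orderOf g := orderOf_pos g
    exact ⟨_, (h.pow h0 (hg.trans (mul_comm _ _))).map_of_injective (f := Units.coeHom L)
      Units.val_injective⟩
  have hcard := hζ.card_nthRootsFinset
  have hmem : ∀ x, x ∈ Polynomial.nthRootsFinset (N j - 1) (1 : L) ↔ x ^ (N j - 1) = 1 :=
    fun x => Polynomial.mem_nthRootsFinset hn 1
  unfold Coord size
  split_ifs with h
  · rw [← hcard]
    refine Nat.subtype_card _ fun x => ?_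
    rw [hmem]
    simp [h, hcard]
  · have h0 : (0 : L) ∉ Polynomial.nthRootsFinset (N j - 1) (1 : L) := by
      rw [hmem, zero_pow hn.ne']
      exact zero_ne_one
    have hc := Finset.card_insert_of_notMem h0
    rw [hcard, Nat.sub_add_cancel (hN j).le] at hc
    conv_rhs => rw [← hc]
    refine Nat.subtype_card _ fun x => ?_
    rw [Finset.mem_insert, hmem]
    obtain ⟨n, hn'⟩ : ∃ n, N j = n + 1 := ⟨N j - 1, (Nat.sub_add_cancel (hN j).le).symm⟩
    simp only [h, hn', pow_succ, Nat.add_sub_cancel, not_false_eq_true, IsEmpty.forall_iff,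
      true_and, forall_const]
    rw [mul_left_eq_self₀]
    tauto

/-- The zero locus is the product of its coordinate sets. -/
def pointsEquivPi (L : Type*) [Field L] (N : Fin m → ℕ) (J : Finset (Fin m)) :
    Points L N J ≃ ∀ j, Coord L N J j where
  toFun P j := ⟨P.1 j, P.2 j⟩
  invFun f := ⟨fun j => (f j).1, fun j => (f j).2⟩
  left_inv _ := rfl
  right_inv _ := rfl

end JAffine
end

/-! ### Hyperbolic pairs: star product, determining sets, rectangle words -/

noncomputable section

namespace Code

variable {K ι α : Type*} [Field K]

theorem injective_comp_natCast_add {K : Type*} {n d : ℕ} (hd : d ≤ n) {η : ZMod n → K}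
    (hη : Function.Injective η) (g : ZMod n) :
    Function.Injective fun k : Fin d => η (((k : ℕ) : ZMod n) + g) := by
  intro k k' h
  have h1 := add_right_cancel (hη h)
  rw [ZMod.natCast_eq_natCast_iff', Nat.mod_eq_of_lt (k.2.trans_le hd),
    Nat.mod_eq_of_lt (k'.2.trans_le hd)] at h1
  exact Fin.ext h1

/-- Vandermonde: for `3 ≤ n` three consecutive residues have distinct images under `η`. -/
theorem quadratic_eq_zero {n : ℕ} (hn : 3 ≤ n) {η : ZMod n → K} (hη : Function.Injective η)
    (g : ZMod n) {c₀ c₁ c₂ : K}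
    (h : ∀ k : Fin 3, c₀ + c₁ * η (((k : ℕ) : ZMod n) + g)
      + c₂ * η (((k : ℕ) : ZMod n) + g) ^ 2 = 0) : c₀ = 0 ∧ c₁ = 0 ∧ c₂ = 0 := by
  have := Matrix.eq_zero_of_forall_index_sum_mul_pow_eq_zero (v := ![c₀, c₁, c₂])
    (injective_comp_natCast_add hn hη g) fun j => by simpa [Fin.sum_univ_three] using h j
  exact ⟨congrFun this 0, congrFun this 1, congrFun this 2⟩

theorem quartic_eq_zero {n : ℕ} (hn : 5 ≤ n) {η : ZMod n → K} (hη : Function.Injective η)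
    (g : ZMod n) {c₀ c₁ c₂ c₃ c₄ : K}
    (h : ∀ k : Fin 5, c₀ + c₁ * η (((k : ℕ) : ZMod n) + g) + c₂ * η (((k : ℕ) : ZMod n) + g) ^ 2
      + c₃ * η (((k : ℕ) : ZMod n) + g) ^ 3 + c₄ * η (((k : ℕ) : ZMod n) + g) ^ 4 = 0) :
    c₀ = 0 ∧ c₁ = 0 ∧ c₂ = 0 ∧ c₃ = 0 ∧ c₄ = 0 := by
  have := Matrix.eq_zero_of_forall_index_sum_mul_pow_eq_zero (v := ![c₀, c₁, c₂, c₃, c₄])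
    (injective_comp_natCast_add hn hη g) fun j => by simpa [Fin.sum_univ_five] using h j
  exact ⟨congrFun this 0, congrFun this 1, congrFun this 2, congrFun this 3, congrFun this 4⟩

/-- `C` is the code of the polynomials of degree at most two in a coordinate `y` that takes `n`
values, and `D` is the sum of `C` and a space `V` of functions of the other coordinate. -/
structure IsHyperbolicPair [Finite α] {n : ℕ} (ε : ι ≃ α × ZMod n) (η : ZMod n → K)
    (V : Submodule K (α → K)) (C D : Submodule K (ι → K)) : Prop where
  three_le : 3 ≤ n
  injective : Function.Injective η
  one_mem : (1 : α → K) ∈ V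
  mem_left : ∀ c, c ∈ C ↔ ∃ c₀ c₁ c₂ : K, ∀ P, c P = c₀ + c₁ * η (ε P).2 + c₂ * η (ε P).2 ^ 2
  mem_right : ∀ d, d ∈ D ↔ ∃ c₁ c₂ : K, ∃ v ∈ V,
    ∀ P, d P = v (ε P).1 + c₁ * η (ε P).2 + c₂ * η (ε P).2 ^ 2

namespace IsHyperbolicPair

variable [Finite α] {n : ℕ} {ε : ι ≃ α × ZMod n} {η : ZMod n → K} {V : Submodule K (α → K)}
  {C D : Submodule K (ι → K)}

/-- `V` enters `D` only in degree zero in `y`, so degrees three and four of a product have constant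
coefficients. -/
theorem exists_of_mem_star (h : IsHyperbolicPair ε η V C D) {f : ι → K} (hf : f ∈ star C D) :
    ∃ g₀ ∈ V, ∃ g₁ ∈ V, ∃ g₂ ∈ V, ∃ c₃ c₄ : K, ∀ P, f P = g₀ (ε P).1 + g₁ (ε P).1 * η (ε P).2
      + g₂ (ε P).1 * η (ε P).2 ^ 2 + c₃ * η (ε P).2 ^ 3 + c₄ * η (ε P).2 ^ 4 := by
  induction hf using Submodule.span_induction with
  | mem f hf =>
    obtain ⟨c, hc, d, hd, rfl⟩ := hf
    obtain ⟨c₀, c₁, c₂, hc⟩ := (h.mem_left c).1 hc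
    obtain ⟨d₁, d₂, v, hv, hd⟩ := (h.mem_right d).1 hd
    refine ⟨c₀ • v, V.smul_mem _ hv, (c₀ * d₁) • 1 + c₁ • v,
      V.add_mem (V.smul_mem _ h.one_mem) (V.smul_mem _ hv), (c₀ * d₂ + c₁ * d₁) • 1 + c₂ • v,
      V.add_mem (V.smul_mem _ h.one_mem) (V.smul_mem _ hv), c₁ * d₂ + c₂ * d₁, c₂ * d₂,
      fun P => ?_⟩
    simp only [hc, hd, Pi.add_apply, Pi.smul_apply, Pi.one_apply, smul_eq_mul]
    ring
  | zero => exact ⟨0, V.zero_mem, 0, V.zero_mem, 0, V.zero_mem, 0, 0, by simp⟩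
  | add f f' _ _ hf hf' =>
    obtain ⟨g₀, h₀, g₁, h₁, g₂, h₂, c₃, c₄, e⟩ := hf
    obtain ⟨g₀', h₀', g₁', h₁', g₂', h₂', c₃', c₄', e'⟩ := hf'
    refine ⟨g₀ + g₀', V.add_mem h₀ h₀', g₁ + g₁', V.add_mem h₁ h₁', g₂ + g₂', V.add_mem h₂ h₂',
      c₃ + c₃', c₄ + c₄', fun P => ?_⟩
    simp only [e, e', Pi.add_apply]
    ring
  | smul t f _ hf =>
    obtain ⟨g₀, h₀, g₁, h₁, g₂, h₂, c₃, c₄, e⟩ := hf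
    refine ⟨t • g₀, V.smul_mem _ h₀, t • g₁, V.smul_mem _ h₁, t • g₂, V.smul_mem _ h₂, t * c₃,
      t * c₄, fun P => ?_⟩
    simp only [e, Pi.smul_apply, smul_eq_mul]
    ring

theorem eq_zero_of_mem_left (h : IsHyperbolicPair ε η V C D) {c : ι → K} (hc : c ∈ C)
    (a : α) (z : ZMod n) (h0 : ∀ k : Fin 3, c (ε.symm (a, z + (k : ℕ))) = 0) : c = 0 := by
  obtain ⟨c₀, c₁, c₂, hc⟩ := (h.mem_left c).1 hc
  obtain ⟨rfl, rfl, rfl⟩ := quadratic_eq_zero h.three_le h.injective z (c₀ := c₀) (c₁ := c₁)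
    (c₂ := c₂) fun k => by
      have := h0 k
      rwa [hc, ε.apply_symm_apply, add_comm z] at this
  funext P
  simp [hc]

theorem finrank_left [Nonempty α] (h : IsHyperbolicPair ε η V C D) : Module.finrank K C = 3 := by
  let Φ : (Fin 3 → K) →ₗ[K] (ι → K) :=
    { toFun := fun k P => k 0 + k 1 * η (ε P).2 + k 2 * η (ε P).2 ^ 2
      map_add' := fun k k' => by
        funext P
        simp only [Pi.add_apply]
        ring
      map_smul' := fun t k => by
        funext P
        simp only [Pi.smul_apply, smul_eq_mul, RingHom.id_apply]
        ring }
  have hinj : Function.Injective Φ := by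
    rw [← LinearMap.ker_eq_bot, LinearMap.ker_eq_bot']
    intro k hk
    obtain ⟨a⟩ := ‹Nonempty α›
    obtain ⟨h0, h1, h2⟩ := quadratic_eq_zero h.three_le h.injective 0 (c₀ := k 0) (c₁ := k 1)
      (c₂ := k 2) fun j => by
        have := congrFun hk (ε.symm (a, ((j : ℕ) : ZMod n) + 0))
        simpa [Φ] using this
    funext j
    fin_cases j <;> assumption
  have hC : C = LinearMap.range Φ := by
    ext c
    rw [h.mem_left, LinearMap.mem_range]
    constructor
    · rintro ⟨c₀, c₁, c₂, hc⟩
      exact ⟨![c₀, c₁, c₂], funext fun P => (hc P).symm⟩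
    · rintro ⟨k, rfl⟩
      exact ⟨k 0, k 1, k 2, fun P => rfl⟩
  rw [hC, LinearMap.finrank_range_of_inj hinj, Module.finrank_fintype_fun_eq_card, Fintype.card_fin]

/-- A small set of coordinates all of whose translates determine the words of `star C D`. -/
theorem exists_determining_set [Nontrivial α] (h : IsHyperbolicPair ε η V C D) :
    ∃ Q : Finset (α × ZMod n), Q.card ≤ 3 * Module.finrank K V + 2 ∧
      (∀ g, ∀ f ∈ star C D, (∀ p ∈ Q, f (ε.symm (p.1, p.2 + g)) = 0) → f = 0) ∧
      ((∀ p, p ∈ Q) → star C D = ⊤) := by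
  classical
  have := Fintype.ofFinite α
  have hn3 := h.three_le
  have : NeZero n := ⟨by omega⟩
  obtain ⟨I, hIc, hI⟩ := exists_information_set V
  obtain ⟨b, hb⟩ : I.Nonempty := by
    rw [Finset.nonempty_iff_ne_empty]
    rintro rfl
    exact one_ne_zero (hI 1 h.one_mem (by simp))
  -- Five positions over `b` determine a quartic in `y`. Subtracting it leaves quadratics over the
  -- other points of `I`, for which three positions suffice.
  refine ⟨I ×ˢ {0, 1, 2} ∪ {(b, 3), (b, 4)}, ?_, ?_, ?_⟩
  · refine (Finset.card_union_le _ _).trans (add_le_add ?_ Finset.card_le_two)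
    rw [Finset.card_product, mul_comm]
    exact Nat.mul_le_mul Finset.card_le_three hIc
  · intro g f hf h0
    obtain ⟨g₀, h₀, g₁, h₁, g₂, h₂, c₃, c₄, e⟩ := h.exists_of_mem_star hf
    have e' : ∀ a z, f (ε.symm (a, z)) = g₀ a + g₁ a * η z + g₂ a * η z ^ 2 + c₃ * η z ^ 3
        + c₄ * η z ^ 4 := fun a z => by rw [e, ε.apply_symm_apply]
    have hb5 : ∀ k : Fin 5, f (ε.symm (b, ((k : ℕ) : ZMod n) + g)) = 0 := by
      intro k
      refine h0 (b, ((k : ℕ) : ZMod n)) ?_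
      fin_cases k <;> simp [hb]
    have hI3 : ∀ a ∈ I, ∀ k : Fin 3, f (ε.symm (a, ((k : ℕ) : ZMod n) + g)) = 0 := by
      intro a ha k
      refine h0 (a, ((k : ℕ) : ZMod n)) ?_
      fin_cases k <;> simp [ha]
    have hbz : ∀ z, f (ε.symm (b, z)) = 0 := by
      intro z
      by_cases hn : 5 ≤ n
      · obtain ⟨p0, p1, p2, p3, p4⟩ := quartic_eq_zero hn h.injective g (c₀ := g₀ b)
          (c₁ := g₁ b) (c₂ := g₂ b) (c₃ := c₃) (c₄ := c₄) fun k => (e' _ _).symm.trans (hb5 k)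
        rw [e', p0, p1, p2, p3, p4]
        ring
      -- For `n < 5` the five positions wrap around and cover the whole line over `b`.
      · have hlt : (z - g).val < 5 := (ZMod.val_lt _).trans (not_le.1 hn)
        have := hb5 ⟨_, hlt⟩
        simpa using this
    have haz : ∀ a ∈ I, ∀ z, f (ε.symm (a, z)) = 0 := by
      intro a ha z
      obtain ⟨p0, p1, p2⟩ := quadratic_eq_zero h.three_le h.injective g (c₀ := g₀ a - g₀ b)
        (c₁ := g₁ a - g₁ b) (c₂ := g₂ a - g₂ b) fun k => by
          have q1 := hI3 a ha k
          have q2 := hbz (((k : ℕ) : ZMod n) + g)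
          rw [e'] at q1 q2
          linear_combination q1 - q2
      have q2 := hbz z
      rw [e'] at q2 ⊢
      linear_combination q2 + p0 + p1 * η z + p2 * η z ^ 2
    funext P
    -- For fixed `y` the word is a function in `V`, hence zero once it vanishes on `I`.
    have hmem : (g₀ + η (ε P).2 • g₁ + η (ε P).2 ^ 2 • g₂
        + (c₃ * η (ε P).2 ^ 3 + c₄ * η (ε P).2 ^ 4) • (1 : α → K)) ∈ V :=
      V.add_mem (V.add_mem (V.add_mem h₀ (V.smul_mem _ h₁)) (V.smul_mem _ h₂))
        (V.smul_mem _ h.one_mem)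
    have hz := congrFun (hI _ hmem fun a ha => by
      have := haz a ha (ε P).2
      rw [e'] at this
      simp only [Pi.add_apply, Pi.smul_apply, Pi.one_apply, smul_eq_mul]
      linear_combination this) (ε P).1
    simp only [Pi.add_apply, Pi.smul_apply, Pi.one_apply, Pi.zero_apply, smul_eq_mul] at hz
    rw [e, Pi.zero_apply]
    linear_combination hz
  · intro hQ
    obtain ⟨a₁, ha₁⟩ := exists_ne b
    have hz3 : ∀ z : ZMod n, z = 0 ∨ z = 1 ∨ z = 2 := by
      intro z
      have := hQ (a₁, z)
      simp only [Finset.mem_union, Finset.mem_product, Finset.mem_insert, Finset.mem_singleton,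
        Prod.mk.injEq, ha₁, false_and, or_false] at this
      exact this.2
    have hIu : ∀ a, a ∈ I := by
      intro a
      by_cases ha : a = b
      · exact ha ▸ hb
      · have := hQ (a, 0)
        simp only [Finset.mem_union, Finset.mem_product, Finset.mem_insert, Finset.mem_singleton,
          Prod.mk.injEq, ha, false_and, or_false] at this
        exact this.1
    have hV : V = ⊤ := by
      apply Submodule.eq_top_of_finrank_eq
      refine le_antisymm (Submodule.finrank_le V) ?_
      rw [Module.finrank_fintype_fun_eq_card, ← Finset.card_univ, ← Finset.eq_univ_iff_forall.2 hIu]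
      exact hIc
    rw [eq_top_iff]
    intro f _
    have hη : ∀ z, ∀ k : Fin 3, k ≠ 0 → η z - η (((k : ℕ) : ZMod n) + z) ≠ 0 := by
      intro z k hk h0
      apply hk
      refine (injective_comp_natCast_add h.three_le h.injective z (a₁ := k) (a₂ := 0) ?_)
      simpa using (sub_eq_zero.1 h0).symm
    -- Now `n = 3` and `V` is everything: `c z` is the Lagrange polynomial at `z` up to the factor
    -- `t z`, and `d z` carries the values of `f` on the line `z`.
    let c : ZMod n → ι → K := fun z P =>
      (η (ε P).2 - η (((1 : Fin 3) : ℕ) + z)) * (η (ε P).2 - η (((2 : Fin 3) : ℕ) + z))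
    let t : ZMod n → K := fun z =>
      ((η z - η (((1 : Fin 3) : ℕ) + z)) * (η z - η (((2 : Fin 3) : ℕ) + z)))⁻¹
    let d : ZMod n → ι → K := fun z P => t z * f (ε.symm ((ε P).1, z))
    have hf : f = ∑ z, fun P => c z P * d z P := by
      funext P
      rw [Finset.sum_apply, Finset.sum_eq_single (ε P).2]
      · have h1 := hη (ε P).2 1 (by simp)
        have h2 := hη (ε P).2 2 (by simp)
        simp only [c, d, t, Prod.mk.eta, ε.symm_apply_apply]
        field_simp
      · intro z _ hz
        have : c z P = 0 := by
          rw [mul_eq_zero, sub_eq_zero, sub_eq_zero]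
          rcases hz3 ((ε P).2 - z) with h0 | h0 | h0
          · exact absurd (sub_eq_zero.1 h0).symm hz
          · left; rw [sub_eq_iff_eq_add.1 h0]; simp
          · right; rw [sub_eq_iff_eq_add.1 h0]; simp
        rw [this, zero_mul]
      · simp
    rw [hf]
    refine Submodule.sum_mem _ fun z _ => Submodule.subset_span ⟨c z, ?_, d z, ?_, rfl⟩
    · rw [h.mem_left]
      refine ⟨η (((1 : Fin 3) : ℕ) + z) * η (((2 : Fin 3) : ℕ) + z),
        -(η (((1 : Fin 3) : ℕ) + z) + η (((2 : Fin 3) : ℕ) + z)), 1, fun P => ?_⟩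
      simp only [c]
      ring
    · rw [h.mem_right]
      exact ⟨0, 0, fun a => t z * f (ε.symm (a, z)), hV ▸ Submodule.mem_top, fun P => by simp [d]⟩

/-- Alternating signs on a rectangle annihilate every sum of a function of `x` and a function of
`y`. -/
theorem exists_mem_dual_hammingNorm_eq_four [Nontrivial α] [Fintype ι] [DecidableEq K]
    (h : IsHyperbolicPair ε η V C D) : ∃ c ∈ dual D, c ≠ 0 ∧ hammingNorm c = 4 := by
  classical
  have := h.three_le
  have : Fact (1 < n) := ⟨by omega⟩
  obtain ⟨a, b, hab⟩ := exists_pair_ne α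
  have hz : (0 : ZMod n) ≠ 1 := zero_ne_one
  obtain ⟨A, hA⟩ : ∃ A, A = ε.symm (a, 0) := ⟨_, rfl⟩
  obtain ⟨B, hB⟩ : ∃ B, B = ε.symm (a, 1) := ⟨_, rfl⟩
  obtain ⟨E, hE⟩ : ∃ E, E = ε.symm (b, 0) := ⟨_, rfl⟩
  obtain ⟨F, hF⟩ : ∃ F, F = ε.symm (b, 1) := ⟨_, rfl⟩
  have hAB : A ≠ B := by simp [hA, hB, hz]
  have hAE : A ≠ E := by simp [hA, hE, hab]
  have hAF : A ≠ F := by simp [hA, hF, hab]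
  have hBE : B ≠ E := by simp [hB, hE, hab]
  have hBF : B ≠ F := by simp [hB, hF, hab]
  have hEF : E ≠ F := by simp [hE, hF, hz]
  let c : ι → K := Pi.single A 1 - Pi.single B 1 - Pi.single E 1 + Pi.single F 1
  have hsupp : Finset.univ.filter (fun P => c P ≠ 0) = {A, B, E, F} := by
    ext P
    simp only [c, Finset.mem_filter, Finset.mem_univ, true_and, Finset.mem_insert,
      Finset.mem_singleton, Pi.add_apply, Pi.sub_apply, Pi.single_apply]
    by_cases h1 : P = A
    · subst h1; simp [hAB, hAE, hAF]
    by_cases h2 : P = B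
    · subst h2; simp [hAB.symm, hBE, hBF]
    by_cases h3 : P = E
    · subst h3; simp [hAE.symm, hBE.symm, hEF]
    by_cases h4 : P = F
    · subst h4; simp [hAF.symm, hBF.symm, hEF.symm]
    simp [h1, h2, h3, h4]
  have hw : hammingNorm c = 4 := by
    change (Finset.univ.filter fun P => c P ≠ 0).card = 4
    rw [hsupp, Finset.card_insert_of_notMem, Finset.card_insert_of_notMem, Finset.card_pair hEF]
    · simp [hBE, hBF]
    · simp [hAB, hAE, hAF]
  refine ⟨c, fun d hd => ?_, ?_, hw⟩
  · obtain ⟨c₁, c₂, v, -, hd⟩ := (h.mem_right d).1 hd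
    have : ∑ P, d P * c P = d A - d B - d E + d F := by
      simp [c, mul_add, mul_sub, Finset.sum_add_distrib, Finset.sum_sub_distrib, Pi.single_apply]
    rw [this]
    simp only [hd, hA, hB, hE, hF, ε.apply_symm_apply]
    ring
  · intro h0
    rw [h0] at hw
    simp at hw

theorem finrank_star_le [Nontrivial α] [Fintype ι] (h : IsHyperbolicPair ε η V C D) :
    Module.finrank K (star C D) ≤ 3 * Module.finrank K V + 2 := by
  classical
  obtain ⟨Q, hQ, hdet, -⟩ := h.exists_determining_set
  let ρ : star C D →ₗ[K] (Q → K) :=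
    (LinearMap.funLeft K K fun p : Q => ε.symm p.1).comp (star C D).subtype
  have hinj : Function.Injective ρ := by
    rw [← LinearMap.ker_eq_bot, LinearMap.ker_eq_bot']
    intro f hf
    refine Subtype.ext (hdet 0 f f.2 fun p hp => ?_)
    simpa [ρ] using congrFun hf ⟨p, hp⟩
  have := LinearMap.finrank_le_finrank_of_injective hinj
  rw [Module.finrank_fintype_fun_eq_card, Fintype.card_coe] at this
  exact this.trans hQ

theorem exists_pirScheme [Finite K] [Nontrivial α] [Fintype ι] (h : IsHyperbolicPair ε η V C D)
    (hne : star C D ≠ ⊤) (M : ℕ) : ∃ S : PIRScheme C M, S.UsesRetrievalCode D ∧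
      ((Fintype.card ι : ℚ) - (3 * Module.finrank K V + 2)) / Fintype.card ι ≤ S.rate := by
  classical
  have := Fintype.ofFinite α
  have : NeZero n := ⟨by have := h.three_le; omega⟩
  obtain ⟨Q, hQ, hdet, htop⟩ := h.exists_determining_set
  have hR : Qᶜ.Nonempty := by
    rw [Finset.nonempty_iff_ne_empty]
    intro h0
    refine hne (htop fun p => ?_)
    rw [Finset.compl_eq_empty_iff] at h0
    rw [h0]
    exact Finset.mem_univ p
  obtain ⟨S, hS, hrate⟩ := PIRScheme.exists_usesRetrievalCode_rate_eq D ε h.finrank_left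
    (fun c hc a z h0 => h.eq_zero_of_mem_left hc a z h0) Qᶜ hR
    (fun g f hf h0 => hdet g f hf fun p hp => h0 p (by simpa using hp)) M
  refine ⟨S, hS, ?_⟩
  rw [hrate]
  refine div_le_div_of_nonneg_right ?_ (Nat.cast_nonneg _)
  have hc := Finset.card_add_card_compl Q
  rw [← Fintype.card_congr ε] at hc
  have hc' : (Q.card : ℚ) + Qᶜ.card = Fintype.card ι := by exact_mod_cast hc
  have hQ' : (Q.card : ℚ) ≤ 3 * Module.finrank K V + 2 := by exact_mod_cast hQ
  linarith

end IsHyperbolicPair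

end Code
end

/-! ### The codes of `deltaC` and `deltaD` -/

noncomputable section
namespace JAffine

variable {K L : Type*} [Field K] [Field L] [Finite K] [Finite L] [Algebra K L]

/-- Orthogonality to all trace words of `X^a` gives an identity over `L`, since the trace form is
nondegenerate. -/
theorem sum_mul_eq_zero_of_mem_dual {m : ℕ} {N : Fin m → ℕ} {J : Finset (Fin m)}
    (hN : ∀ j, 1 < N j) {Δ : Set (Fin m → ℕ)} {a : Fin m → ℕ}
    (ha : cyclotomic (Nat.card K) N J a ⊆ Δ) {c : Points L N J → K}
    (hc : c ∈ Code.dual (subfieldSubcode K L N J Δ)) :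
    ∑ P : Points L N J, algebraMap K L (c P) * ∏ j, P.1 j ^ a j = 0 := by
  refine eq_zero_of_trace_mul_eq_zero (K := K) _ fun l => ?_
  rw [← hc _ (traceWord_mem_subfieldSubcode hN ha l), Finset.mul_sum, map_sum]
  refine Finset.sum_congr rfl fun P _ => ?_
  rw [mul_left_comm, ← Algebra.smul_def, map_smul, smul_eq_mul, mul_comm, traceWord]

theorem card_points {m : ℕ} {N : Fin m → ℕ} {J : Finset (Fin m)} (hN : ∀ j, 1 < N j)
    (hdvd : ∀ j, N j - 1 ∣ Nat.card L - 1) : Fintype.card (Points L N J) = length N J := by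
  rw [Fintype.card_eq_nat_card, Nat.card_congr (pointsEquivPi L N J), Nat.card_pi, length]
  exact Finset.prod_congr rfl fun j _ => card_coord hN j (hdvd j)

variable {N : Fin 2 → ℕ} {J : Finset (Fin 2)}

/-- `q ≡ 1` modulo `N 1 - 1`, so multiplication by `q` fixes exponents of `y`. -/
theorem cyclotomic_second {q : ℕ} (hq : 1 ≤ q) (hN1 : N 1 - 1 ∣ q - 1) {e : ℕ}
    (he : e < size N J 1) : cyclotomic q N J ![0, e] = {![0, e]} := by
  have key : ∀ i, reduce N J (fun j => q ^ i * ![0, e] j) = ![0, e] := by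
    intro i
    have hmod : q ^ i * e ≡ e [MOD N 1 - 1] := by
      have h1 : q ≡ 1 [MOD N 1 - 1] := ((Nat.modEq_iff_dvd' hq).2 hN1).symm
      simpa using (h1.pow i).mul_right e
    have hpos : 0 < q ^ i := Nat.pow_pos hq
    funext j
    fin_cases j
    · simp [reduce]
    · unfold size at he
      simp only [reduce, Fin.mk_one, Matrix.cons_val_one, Matrix.cons_val_fin_one]
      split_ifs at he ⊢ with h1 h2
      · rw [hmod, Nat.mod_eq_of_lt he]
      · rcases Nat.mul_eq_zero.1 h2 with h | h
        · omega
        · exact h.symm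
      · have he0 : 1 ≤ e := Nat.one_le_iff_ne_zero.2 fun h => h2 (by rw [h, mul_zero])
        have hqe : 1 ≤ q ^ i * e := Nat.mul_pos hpos he0
        have h3 : q ^ i * e - 1 ≡ e - 1 [MOD N 1 - 1] := by
          refine Nat.ModEq.add_right_cancel' 1 ?_
          rwa [Nat.sub_add_cancel hqe, Nat.sub_add_cancel he0]
        rw [h3, Nat.mod_eq_of_lt (by omega), Nat.sub_add_cancel he0]
  unfold cyclotomic
  simp_rw [key]
  exact Set.range_const

/-- For `0 ∈ J`, `q` is prime to `N 0 - 1`, so no conjugate of a nonzero exponent is `0`. This is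
what makes `1` a representative. -/
theorem reduce_first {q r : ℕ} (hq : 1 ≤ q) (hr : r ≠ 0) (hN0 : N 0 - 1 ∣ q ^ r - 1) {e : ℕ}
    (he : 0 < e) (he' : e < size N J 0) (i : ℕ) :
    ∃ b, 0 < b ∧ reduce N J (fun j => q ^ i * ![e, 0] j) = ![b, 0] := by
  refine ⟨reduce N J (fun j => q ^ i * ![e, 0] j) 0, ?_, ?_⟩
  · have hpos : 0 < q ^ i := Nat.pow_pos hq
    unfold size at he'
    by_cases h1 : 0 ∈ J
    · simp only [reduce, h1, if_true, Matrix.cons_val_zero] at he' ⊢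
      rw [Nat.pos_iff_ne_zero]
      intro h0
      have hcop : Nat.Coprime (N 0 - 1) (q ^ i) := by
        have h1 : Nat.Coprime (q ^ r - 1) (q ^ r) := by
          have : q ^ r = q ^ r - 1 + 1 := (Nat.sub_add_cancel (Nat.pow_pos hq)).symm
          conv_rhs => rw [this]
          simp
        exact ((h1.coprime_dvd_left hN0).coprime_dvd_right (dvd_pow_self q hr)).pow_right i
      exact absurd (Nat.le_of_dvd he (hcop.dvd_of_dvd_mul_left (Nat.dvd_of_mod_eq_zero h0)))
        (not_le.2 he')
    · simp only [reduce, h1, if_false, Matrix.cons_val_zero]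
      exact lt_of_lt_of_eq (Nat.succ_pos _) (if_neg (Nat.mul_pos hpos he).ne').symm
  · funext j
    fin_cases j
    · rfl
    · simp [reduce]

theorem toLex_le_toLex_first {a b : ℕ} (h : a ≤ b) : toLex ![a, 0] ≤ toLex ![b, 0] := by
  apply Pi.toLex_monotone
  intro j
  fin_cases j <;> simp [h]

theorem first_positive_rep {q r : ℕ} (hq : 1 ≤ q) (hr : r ≠ 0)
    (hN0 : N 0 - 1 ∣ q ^ r - 1) {a : ℕ} (ha : IsLeast {a ∈ firstReps q N J | 0 < a} a)
    (hs1 : 0 < size N J 1) : a = 1 := by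
  have has : a < size N J 0 := ha.1.1.1 0
  refine le_antisymm (ha.2 ⟨⟨?_, ?_⟩, one_pos⟩) ha.1.2
  · intro j
    fin_cases j
    · exact lt_of_le_of_lt ha.1.2 has
    · exact hs1
  · rintro _ ⟨i, rfl⟩
    obtain ⟨b, hb, h⟩ := reduce_first hq hr hN0 one_pos (lt_of_le_of_lt ha.1.2 has) i
    dsimp only
    rw [h]
    exact toLex_le_toLex_first hb

/-- The second positive representative is `2` unless `2` is conjugate to `1`. -/
theorem second_positive_rep {q r : ℕ} (hq : 1 ≤ q) (hr : r ≠ 0) (hN0 : N 0 - 1 ∣ q ^ r - 1)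
    {a : ℕ} (ha : IsLeast {a ∈ firstReps q N J | 1 < a} a) (hs1 : 0 < size N J 1) :
    a = 2 ∨ ∃ i, reduce N J (fun j => q ^ i * ![2, 0] j) = ![1, 0] := by
  have has : a < size N J 0 := ha.1.1.1 0
  by_cases h2 : 2 ∈ firstReps q N J
  · exact Or.inl (le_antisymm (ha.2 ⟨h2, one_lt_two⟩) ha.1.2)
  · right
    by_contra! hcon
    refine h2 ⟨?_, ?_⟩
    · intro j
      fin_cases j
      · exact lt_of_le_of_lt ha.1.2 has
      · exact hs1
    · rintro _ ⟨i, rfl⟩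
      obtain ⟨b, hb, h⟩ := reduce_first hq hr hN0 two_pos (lt_of_le_of_lt ha.1.2 has) i
      have hb1 : b ≠ 1 := fun hb1 => hcon i (hb1 ▸ h)
      dsimp only
      rw [h]
      exact toLex_le_toLex_first (by omega)

omit [Finite L] [Algebra K L] in
theorem Coord.pow_card (hN : ∀ j, 1 < N j) (hN1 : N 1 - 1 ∣ Nat.card K - 1) (x : Coord L N J 1) :
    x.1 ^ Nat.card K = x.1 := by
  have hq : 1 ≤ Nat.card K := Nat.card_pos
  have h : x.1 = 0 ∨ x.1 ^ (N 1 - 1) = 1 := by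
    by_cases h1 : 1 ∈ J
    · exact Or.inr (x.2.1 h1)
    · have h2 : x.1 ^ (N 1 - 1) * x.1 = x.1 := by
        rw [← pow_succ, Nat.sub_add_cancel (hN 1).le]
        exact x.2.2 h1
      exact (mul_left_eq_self₀.1 h2).symm
  rcases h with h | h
  · rw [h, zero_pow (by omega)]
  · obtain ⟨d, hd⟩ := hN1
    rw [← Nat.sub_add_cancel hq, pow_succ, hd, pow_mul, h, one_pow, one_mul]

variable (K) in
/-- The functions `c + tr (l x^a) + tr (l' x^b)` of the first coordinate `x`. -/
def firstFunctions (N : Fin 2 → ℕ) (J : Finset (Fin 2)) (a b : ℕ) :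
    Submodule K (Coord L N J 0 → K) :=
  LinearMap.range (LinearMap.pi fun x : Coord L N J 0 =>
    LinearMap.coprod LinearMap.id (LinearMap.coprod
      ((Algebra.trace K L).comp (LinearMap.mulRight K (x.1 ^ a)))
      ((Algebra.trace K L).comp (LinearMap.mulRight K (x.1 ^ b)))))

omit [Finite K] [Finite L] in
theorem mem_firstFunctions {a b : ℕ} {v : Coord L N J 0 → K} : v ∈ firstFunctions K N J a b ↔
    ∃ (c : K) (l l' : L), ∀ x, v x = c +
      (Algebra.trace K L (l * x.1 ^ a) + Algebra.trace K L (l' * x.1 ^ b)) := by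
  constructor
  · rintro ⟨⟨c, l, l'⟩, rfl⟩
    exact ⟨c, l, l', fun x => rfl⟩
  · rintro ⟨c, l, l', h⟩
    exact ⟨⟨c, l, l'⟩, funext fun x => (h x).symm⟩

omit [Finite K] in
theorem finrank_firstFunctions_le (a b : ℕ) :
    Module.finrank K (firstFunctions K (L := L) N J a b) ≤ 2 * Module.finrank K L + 1 := by
  refine (LinearMap.finrank_range_le _).trans ?_
  rw [Module.finrank_prod, Module.finrank_prod, Module.finrank_self]
  omega

theorem exists_isHyperbolicPair (hN : ∀ j, 1 < N j)
    (hN1 : N 1 - 1 ∣ Nat.card K - 1) (hN1' : N 1 - 1 ∣ Nat.card L - 1) (hs1 : 2 < size N J 1)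
    (a b : ℕ) :
    ∃ (ε : Points L N J ≃ Coord L N J 0 × ZMod (size N J 1)) (η : ZMod (size N J 1) → K),
      Code.IsHyperbolicPair ε η (firstFunctions K N J a b)
        (subfieldSubcode K L N J (deltaC (Nat.card K) N J))
        (subfieldSubcode K L N J (deltaD (Nat.card K) N J a b)) := by
  obtain ⟨μ, hμ⟩ := Algebra.trace_surjective K L 1
  have hinj := FaithfulSMul.algebraMap_injective K L
  have : NeZero (size N J 1) := ⟨by omega⟩
  -- Any bijection will do: the cyclic structure only labels the values of `y`.
  obtain ⟨ω⟩ : Nonempty (Coord L N J 1 ≃ ZMod (size N J 1)) :=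
    Finite.card_eq.1 (by rw [card_coord hN 1 hN1', Nat.card_zmod])
  let ε : Points L N J ≃ Coord L N J 0 × ZMod (size N J 1) :=
    ((pointsEquivPi L N J).trans (piFinTwoEquiv _)).trans (Equiv.prodCongr (Equiv.refl _) ω)
  let η : ZMod (size N J 1) → K := fun z => Algebra.trace K L (μ * (ω.symm z).1)
  have hη : ∀ z, algebraMap K L (η z) = (ω.symm z).1 := fun z => by
    rw [algebraMap_trace_mul_of_pow_eq _ _ (Coord.pow_card hN hN1 _), hμ, map_one, one_mul]
  have hε1 : ∀ P, ((ε P).1).1 = P.1 0 := fun P => rfl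
  have hε2 : ∀ P, algebraMap K L (η (ε P).2) = P.1 1 := fun P => by
    rw [hη]
    exact congrArg Subtype.val (ω.symm_apply_apply _)
  have hsecond : ∀ (l : L) (e : ℕ) (P : Points L N J),
      traceWord K N J l ![0, e] P = Algebra.trace K L l * η (ε P).2 ^ e := by
    intro l e P
    apply hinj
    rw [traceWord, Fin.prod_univ_two, algebraMap_trace_mul_of_pow_eq, map_mul, map_pow, hε2]
    · simp
    · simp only [Matrix.cons_val_zero, pow_zero, one_mul, Matrix.cons_val_one,
        Matrix.cons_val_fin_one]
      rw [← hε2, ← pow_mul, mul_comm, pow_mul, hη, Coord.pow_card hN hN1]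
  have hfirst : ∀ (l : L) (e : ℕ) (P : Points L N J),
      traceWord K N J l ![e, 0] P = Algebra.trace K L (l * (ε P).1.1 ^ e) := by
    intro l e P
    rw [traceWord, Fin.prod_univ_two, hε1]
    simp
  have hsmul : ∀ c : K, Algebra.trace K L (c • μ) = c := fun c => by
    rw [map_smul, hμ, smul_eq_mul, mul_one]
  have hCD : ∀ {x}, x ⊆ deltaC (Nat.card K) N J → x ⊆ deltaD (Nat.card K) N J a b :=
    fun h => h.trans (Set.subset_union_left.trans Set.subset_union_left)
  have hC0 : cyclotomic (Nat.card K) N J ![0, 0] ⊆ deltaC (Nat.card K) N J :=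
    Set.subset_union_left.trans Set.subset_union_left
  have hC1 : cyclotomic (Nat.card K) N J ![0, 1] ⊆ deltaC (Nat.card K) N J :=
    Set.subset_union_right.trans Set.subset_union_left
  have hC2 : cyclotomic (Nat.card K) N J ![0, 2] ⊆ deltaC (Nat.card K) N J :=
    Set.subset_union_right
  refine ⟨ε, η, hs1, ?_, ?_, fun c => ⟨fun hc => ?_, ?_⟩, fun d => ⟨fun hd => ?_, ?_⟩⟩
  · intro z z' h
    have := congrArg (algebraMap K L) h
    rw [hη, hη] at this
    exact ω.symm.injective (Subtype.ext this)
  · exact mem_firstFunctions.2 ⟨1, 0, 0, by simp⟩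
  · have hc' := subfieldSubcode_le_span_traceWord (S := {![0, 0], ![0, 1], ![0, 2]}) hN (by
      rintro x ((hx | hx) | hx)
      · exact ⟨_, by simp, hx⟩
      · exact ⟨_, by simp, hx⟩
      · exact ⟨_, by simp, hx⟩) hc
    clear hc
    induction hc' using Submodule.span_induction with
    | mem v hv =>
      obtain ⟨x, rfl | rfl | rfl, l, rfl⟩ := hv
      · exact ⟨Algebra.trace K L l, 0, 0, fun P => by rw [hsecond]; ring⟩
      · exact ⟨0, Algebra.trace K L l, 0, fun P => by rw [hsecond]; ring⟩
      · exact ⟨0, 0, Algebra.trace K L l, fun P => by rw [hsecond]; ring⟩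
    | zero => exact ⟨0, 0, 0, by simp⟩
    | add v w _ _ hv hw =>
      obtain ⟨c₀, c₁, c₂, h⟩ := hv
      obtain ⟨d₀, d₁, d₂, h'⟩ := hw
      exact ⟨c₀ + d₀, c₁ + d₁, c₂ + d₂, fun P => by rw [Pi.add_apply, h, h']; ring⟩
    | smul t v _ hv =>
      obtain ⟨c₀, c₁, c₂, h⟩ := hv
      exact ⟨t * c₀, t * c₁, t * c₂, fun P => by rw [Pi.smul_apply, h, smul_eq_mul]; ring⟩
  · rintro ⟨c₀, c₁, c₂, h⟩
    have : c = traceWord K N J (c₀ • μ) ![0, 0] + traceWord K N J (c₁ • μ) ![0, 1]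
        + traceWord K N J (c₂ • μ) ![0, 2] := by
      funext P
      simp only [h, Pi.add_apply, hsecond, hsmul]
      ring
    rw [this]
    exact Submodule.add_mem _ (Submodule.add_mem _ (traceWord_mem_subfieldSubcode hN hC0 _)
      (traceWord_mem_subfieldSubcode hN hC1 _)) (traceWord_mem_subfieldSubcode hN hC2 _)
  · have hd' := subfieldSubcode_le_span_traceWord
      (S := {![0, 0], ![0, 1], ![0, 2], ![a, 0], ![b, 0]}) hN (by
        rintro x ((((hx | hx) | hx) | hx) | hx)
        · exact ⟨_, by simp, hx⟩
        · exact ⟨_, by simp, hx⟩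
        · exact ⟨_, by simp, hx⟩
        · exact ⟨_, by simp, hx⟩
        · exact ⟨_, by simp, hx⟩) hd
    clear hd
    induction hd' using Submodule.span_induction with
    | mem v hv =>
      obtain ⟨x, rfl | rfl | rfl | rfl | rfl, l, rfl⟩ := hv
      · exact ⟨0, 0, fun _ => Algebra.trace K L l,
          mem_firstFunctions.2 ⟨Algebra.trace K L l, 0, 0, by simp⟩,
          fun P => by rw [hsecond]; ring⟩
      · exact ⟨Algebra.trace K L l, 0, 0, Submodule.zero_mem _,
          fun P => by rw [hsecond, Pi.zero_apply]; ring⟩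
      · exact ⟨0, Algebra.trace K L l, 0, Submodule.zero_mem _,
          fun P => by rw [hsecond, Pi.zero_apply]; ring⟩
      · exact ⟨0, 0, fun x => Algebra.trace K L (l * x.1 ^ a),
          mem_firstFunctions.2 ⟨0, l, 0, by simp⟩, fun P => by rw [hfirst]; ring⟩
      · exact ⟨0, 0, fun x => Algebra.trace K L (l * x.1 ^ b),
          mem_firstFunctions.2 ⟨0, 0, l, by simp⟩, fun P => by rw [hfirst]; ring⟩
    | zero => exact ⟨0, 0, 0, Submodule.zero_mem _, by simp⟩
    | add v w _ _ hv hw =>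
      obtain ⟨c₁, c₂, g, hg, h⟩ := hv
      obtain ⟨d₁, d₂, g', hg', h'⟩ := hw
      exact ⟨c₁ + d₁, c₂ + d₂, g + g', Submodule.add_mem _ hg hg',
        fun P => by rw [Pi.add_apply, Pi.add_apply, h, h']; ring⟩
    | smul t v _ hv =>
      obtain ⟨c₁, c₂, g, hg, h⟩ := hv
      exact ⟨t * c₁, t * c₂, t • g, Submodule.smul_mem _ t hg,
        fun P => by rw [Pi.smul_apply, Pi.smul_apply, h, smul_eq_mul, smul_eq_mul]; ring⟩
  · rintro ⟨c₁, c₂, v, hv, h⟩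
    obtain ⟨c₀, l, l', hv⟩ := mem_firstFunctions.1 hv
    have : d = traceWord K N J (c₀ • μ) ![0, 0] + traceWord K N J (c₁ • μ) ![0, 1]
        + traceWord K N J (c₂ • μ) ![0, 2] + traceWord K N J l ![a, 0]
        + traceWord K N J l' ![b, 0] := by
      funext P
      simp only [h, hv, Pi.add_apply, hsecond, hsmul, hfirst]
      ring
    rw [this]
    exact Submodule.add_mem _ (Submodule.add_mem _ (Submodule.add_mem _ (Submodule.add_mem _
      (traceWord_mem_subfieldSubcode hN (hCD hC0) _)
      (traceWord_mem_subfieldSubcode hN (hCD hC1) _))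
      (traceWord_mem_subfieldSubcode hN (hCD hC2) _))
      (traceWord_mem_subfieldSubcode hN (Set.subset_union_right.trans Set.subset_union_left) _))
      (traceWord_mem_subfieldSubcode hN Set.subset_union_right _)

/-- The dual of the code of `Δ_D` has no nonzero word of weight at most three. -/
theorem eq_zero_of_mem_dual_deltaD [DecidableEq K] {r : ℕ}
    (hr0 : r ≠ 0) (hN : ∀ j, 1 < N j) (hN0 : N 0 - 1 ∣ Nat.card K ^ r - 1)
    (hs1 : 0 < size N J 1) {a : ℕ} (ha : IsLeast {a ∈ firstReps (Nat.card K) N J | 1 < a} a)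
    {c : Points L N J → K}
    (hc : c ∈ Code.dual (subfieldSubcode K L N J (deltaD (Nat.card K) N J 1 a)))
    (hw : hammingNorm c ≤ 3) : c = 0 := by
  classical
  have hinj := FaithfulSMul.algebraMap_injective K L
  have hsum : ∀ u : Fin 2 → ℕ, cyclotomic (Nat.card K) N J u ⊆ deltaD (Nat.card K) N J 1 a →
      ∑ P : Points L N J, algebraMap K L (c P) * (P.1 0 ^ u 0 * P.1 1 ^ u 1) = 0 := by
    intro u hu
    simpa [Fin.prod_univ_two] using sum_mul_eq_zero_of_mem_dual hN hu hc
  have s0 := hsum ![0, 0] fun x hx => Or.inl (Or.inl (Or.inl (Or.inl hx)))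
  have s1 := hsum ![0, 1] fun x hx => Or.inl (Or.inl (Or.inl (Or.inr hx)))
  have s2 := hsum ![0, 2] fun x hx => Or.inl (Or.inl (Or.inr hx))
  have t1 := hsum ![1, 0] fun x hx => Or.inl (Or.inr hx)
  have t2 := hsum ![a, 0] fun x hx => Or.inr hx
  simp only [Matrix.cons_val_zero, Matrix.cons_val_one, Matrix.cons_val_fin_one, pow_zero, pow_one,
    mul_one, one_mul] at s0 s1 s2 t1 t2
  -- If `2` is conjugate to `1`, a power of Frobenius fixes the `K`-valued `c` and carries the
  -- second power sum to the first.
  have t2' : ∑ P : Points L N J, algebraMap K L (c P) * P.1 0 ^ 2 = 0 := by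
    rcases second_positive_rep Nat.card_pos hr0 hN0 ha hs1 with rfl | ⟨i, hi⟩
    · exact t2
    · obtain ⟨φ, hφ⟩ := exists_algEquiv_eq_pow K L i
      apply φ.injective
      rw [map_zero, map_sum, ← t1]
      refine Finset.sum_congr rfl fun P _ => ?_
      have h := prod_pow_reduce_mul hN P (Nat.card K) i ![2, 0]
      rw [hi] at h
      simp only [Fin.prod_univ_two, Matrix.cons_val_zero, Matrix.cons_val_one,
        Matrix.cons_val_fin_one, pow_zero, pow_one, mul_one] at h
      rw [map_mul, φ.commutes, hφ, ← h]
  have hc0 := Code.eq_zero_of_powerSums_eq_zero (fun P => algebraMap K L (c P))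
    (fun P : Points L N J => P.1 0) (fun P => P.1 1)
    (fun P P' h0 h1 => Subtype.ext (funext fun j => by fin_cases j <;> assumption))
    (by rwa [hammingNorm_comp (fun _ => algebraMap K L) (fun _ => hinj) (fun _ => map_zero _)])
    s0 t1 t2' s1 s2
  funext P
  exact hinj (by rw [Pi.zero_apply, map_zero]; exact congrFun hc0 P)

end JAffine
end

/-! ### The main theorem -/

theorem mainTheorem10 {K L : Type*} [Field K] [Field L] [Finite K] [Finite L] [Algebra K L]
    (q r : ℕ) (hq : Nat.card K = q) (hr : Nat.card L = q ^ r)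
    (N : Fin 2 → ℕ) (J : Finset (Fin 2)) (hN : ∀ j, 1 < N j)
    (hN0 : N 0 - 1 ∣ q ^ r - 1) (hN1 : N 1 - 1 ∣ q - 1)
    (hE : ![0, 2] ∈ JAffine.exponents N J)
    (a₁ a₂ : ℕ)
    (ha₁ : IsLeast {a ∈ JAffine.firstReps q N J | 0 < a} a₁)
    (ha₂ : IsLeast {a ∈ JAffine.firstReps q N J | a₁ < a} a₂)
    (C D : Submodule K (JAffine.Points L N J → K))
    (hC : C = JAffine.subfieldSubcode K L N J (JAffine.deltaC q N J))
    (hD : D = JAffine.subfieldSubcode K L N J (JAffine.deltaD q N J a₁ a₂)) :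
    JAffine.deltaC q N J = {![0, 0], ![0, 1], ![0, 2]} ∧
    Fintype.card (JAffine.Points L N J) = JAffine.length N J ∧
    Code.HasMinDist (Code.dual D) 4 ∧
    (JAffine.length N J : ℤ) - (3 * (2 * r) + 5) ≤
      Module.finrank K (Code.dual (Code.star C D)) ∧
    (Code.star C D ≠ ⊤ → ∀ M : ℕ, ∃ S : PIRScheme C M,
      S.UsesRetrievalCode D ∧ S.ResistsCollusion 3 ∧
      ((JAffine.length N J : ℚ) - (3 * (2 * r) + 5)) / JAffine.length N J ≤ S.rate) := by
  classical
  subst hq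
  have hq1 : 1 < Nat.card K := Finite.one_lt_card
  have hrank : Module.finrank K L = r := by
    rw [Module.natCard_eq_pow_finrank (K := K)] at hr
    exact Nat.pow_right_injective hq1 hr
  have hr0 : r ≠ 0 := hrank ▸ Module.finrank_pos.ne'
  have hs1 : 2 < JAffine.size N J 1 := hE 1
  have ha₁1 : a₁ = 1 := JAffine.first_positive_rep hq1.le hr0 hN0 ha₁ (by omega)
  subst ha₁1
  -- The existence of `a₂ ≥ 2` provides the two values of `x` that a rectangle needs.
  have hs0 : 2 < JAffine.size N J 0 := lt_of_le_of_lt ha₂.1.2 (ha₂.1.1.1 0)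
  have hN0' : N 0 - 1 ∣ Nat.card L - 1 := hr ▸ hN0
  have hN1' : N 1 - 1 ∣ Nat.card L - 1 := by
    rw [hr]
    exact hN1.trans (Nat.sub_one_dvd_pow_sub_one _ _)
  have hcard : Fintype.card (JAffine.Points L N J) = JAffine.length N J :=
    JAffine.card_points hN (Fin.forall_fin_two.2 ⟨hN0', hN1'⟩)
  have hnt : Nontrivial (JAffine.Coord L N J 0) := by
    rw [← Finite.one_lt_card_iff_nontrivial, JAffine.card_coord hN 0 hN0']
    omega
  obtain ⟨ε, η, hpair⟩ := JAffine.exists_isHyperbolicPair (K := K) hN hN1 hN1' hs1 1 a₂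
  have hV := JAffine.finrank_firstFunctions_le (K := K) (L := L) (N := N) (J := J) 1 a₂
  rw [hrank] at hV
  have hdual : ∀ c ∈ Code.dual D, hammingNorm c ≤ 3 → c = 0 := by
    rw [hD]
    exact fun c hc hw => JAffine.eq_zero_of_mem_dual_deltaD hr0 hN hN0 (by omega) ha₂ hc hw
  rw [← hC, ← hD] at hpair
  refine ⟨?_, hcard, ⟨?_, ?_⟩, ?_, fun hne M => ?_⟩
  · rw [JAffine.deltaC, JAffine.cyclotomic_second hq1.le hN1 (by omega),
      JAffine.cyclotomic_second hq1.le hN1 (by omega), JAffine.cyclotomic_second hq1.le hN1 hs1]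
    ext x
    simp only [Set.mem_union, Set.mem_insert_iff, Set.mem_singleton_iff, or_assoc]
  · obtain ⟨c, hc, hc0, hw⟩ := hpair.exists_mem_dual_hammingNorm_eq_four
    exact ⟨c, hc, hc0, by convert hw⟩
  · rintro w ⟨c, hc, hc0, rfl⟩
    by_contra! hlt
    refine hc0 (hdual c hc ?_)
    convert Nat.le_of_lt_succ hlt
  · have h1 := Code.card_le_finrank_dual_add_finrank (Code.star C D)
    have h2 := hpair.finrank_star_le
    omega
  · obtain ⟨S, hS, hrate⟩ := hpair.exists_pirScheme hne M
    refine ⟨S, hS, hS.resistsCollusion 3 hdual, le_trans ?_ hrate⟩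
    rw [hcard]
    refine div_le_div_of_nonneg_right ?_ (Nat.cast_nonneg _)
    have : (Module.finrank K (JAffine.firstFunctions K (L := L) N J 1 a₂) : ℚ) ≤ 2 * r + 1 := by
      exact_mod_cast hV
    linarith
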